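/- Let $k$ be a field of characteristic zero. For $n$ points $p_1,\dots,p_n\in\mathbb P^3(K)$, where $K$ is an extension field of $k$ (possibly $K=k$), let $I(p_1,\dots,p_n)=\bigcap_j \mathfrak m_{p_j}\subset K[x_0,x_1,x_2,x_3]$ be the ideal of the points, where $\mathfrak m_p$ is the ideal generated by the forms vanishing at $p$. For an ideal $I\subset R=K[x_0,x_1,x_2,x_3]$ let $I^{(m)}=R\cap\bigcap_{\mathfrak p\in \mathrm{Ass}(R/I)} I^mR_{\mathfrak p}$ be its $m$-th symbolic power, $\alpha(I)$ the least degree of a nonzero form in $I$, and $\gamma(I)=\lim_{m\to\infty}\alpha(I^{(m)})/m$ its Waldschmidt constant. The points $p_1,\dots,p_n\in\mathbb P^3(K)$ are generic over $k$ if $(p_1,\dots,p_n)$ lies in no proper Zariski closed subset of $(\mathbb P^3)^n$ defined over $k$. For every $n\ge 1$ the Waldschmidt constant $\gamma(I(1^{\times n}))$ of $n$ generic points of $\mathbb P^3$ is understood as the real number $\gamma_n$ such that (i) for all extension fields $K$ of $k$ and all $p_1,\dots,p_n\in\mathbb P^3(K)$ generic over $k$, the limit $\gamma(I(p_1,\dots,p_n))$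 exists and equals $\gamma_n$; and (ii) for each $m\geq 0$, $\alpha(I(p_1,\dots,p_n)^{(m)})$ takes a constant value $a_m$ for points $p_1,\dots,p_n\in\mathbb P^3(k)$ in general position (that is, for all $(p_1,\dots,p_n)$ in a nonempty Zariski open subset of $(\mathbb P^3)^n$, which may depend on $m$), and $\lim_{m\to\infty} a_m/m=\gamma_n$. Claim: if $r,s\ge 1$ and $n\ge r\cdot 8^s$ are integers, then the numbers $\gamma_n$ and $\gamma_r$ exist, and $$\gamma_n\ \ge\ 2^s\,\gamma_r .$$ -/

import Mathlib

open Filter Topology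
open scoped LinearAlgebra.Projectivization

noncomputable section

universe u

/-- The `m`-th symbolic power `I^(m)`: the elements of `R` that lie in `I^m R_P` for every
associated prime `P` of `I` (that is, of the module `R / I`). -/
def symbolicPower {R : Type*} [CommRing R] (I : Ideal R) (m : ℕ) : Ideal R :=
  ⨅ (P : Ideal R) (hP : P ∈ associatedPrimes R (R ⧸ I)),
    haveI : P.IsPrime := hP.isPrime
    ((I ^ m).map (algebraMap R (Localization.AtPrime P))).comap
      (algebraMap R (Localization.AtPrime P))

/-- `α(I)`: the least degree of a nonzero form in `I`. -/
def initialDegree {σ K : Type*} [Field K] (I : Ideal (MvPolynomial σ K)) : ℕ :=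
  sInf {t | ∃ f ∈ I, f ≠ 0 ∧ f.IsHomogeneous t}

/-- `g` is the Waldschmidt constant of `I`: the limit of `α(I^(m)) / m` exists and equals `g`. -/
def HasWaldschmidtConstant {σ K : Type*} [Field K] (I : Ideal (MvPolynomial σ K)) (g : ℝ) :
    Prop :=
  Tendsto (fun m : ℕ => (initialDegree (symbolicPower I m) : ℝ) / m) atTop (𝓝 g)

/-- Projective three-space: the set of `K`-points of `ℙ³`. -/
abbrev P3 (K : Type*) [Field K] : Type _ := ℙ K (Fin 4 → K)

/-- The ideal generated by the forms that vanish at a point of `ℙ³`. (For a form, vanishing does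
not depend on the choice of homogeneous coordinates.) -/
def pointIdeal {K : Type*} [Field K] (p : P3 K) : Ideal (MvPolynomial (Fin 4) K) :=
  Ideal.span {f | (∃ d : ℕ, f.IsHomogeneous d) ∧ MvPolynomial.eval p.rep f = 0}

/-- The fat points ideal with support `p 0, …, p (n-1)` and multiplicities `m j`. -/
def fatPointsIdeal {K : Type*} [Field K] {n : ℕ} (p : Fin n → P3 K) (m : Fin n → ℕ) :
    Ideal (MvPolynomial (Fin 4) K) :=
  ⨅ j, pointIdeal (p j) ^ m j

/-- The ideal of the (simple) points `p 0, …, p (n-1)`: all multiplicities are `1`. -/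
def pointsIdeal {K : Type*} [Field K] {n : ℕ} (p : Fin n → P3 K) :
    Ideal (MvPolynomial (Fin 4) K) :=
  fatPointsIdeal p (fun _ => 1)

/-- A polynomial in `n` groups of four variables that is homogeneous in each group separately. -/
def IsMultihomogeneous {k : Type*} [Field k] {n : ℕ} (F : MvPolynomial (Fin n × Fin 4) k) :
    Prop :=
  ∃ d : Fin n → ℕ,
    F.IsWeightedHomogeneous (fun x : Fin n × Fin 4 => (Pi.single x.1 1 : Fin n → ℕ)) d

/-- The multihomogeneous polynomial `F` over `k` does not vanish at the tuple `p` of points of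
`ℙ³(K)`, for an extension field `K` of `k`. -/
def NonvanishingAt {k K : Type*} [Field k] [Field K] [Algebra k K] {n : ℕ}
    (F : MvPolynomial (Fin n × Fin 4) k) (p : Fin n → P3 K) : Prop :=
  MvPolynomial.aeval (fun x : Fin n × Fin 4 => (p x.1).rep x.2) F ≠ 0

/-- The `n` points `p j` of `ℙ³(K)` are generic over the subfield `k`: the tuple lies in no
proper closed subset of `(ℙ³)ⁿ` that is defined over `k`. -/
def IsGenericTuple (k : Type*) {K : Type*} [Field k] [Field K] [Algebra k K] {n : ℕ}
    (p : Fin n → P3 K) : Prop :=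
  ∀ F : MvPolynomial (Fin n × Fin 4) k, IsMultihomogeneous F → F ≠ 0 → NonvanishingAt F p

/-- The property `Q` holds for `n` points of `ℙ³(k)` in general position: it holds on a nonempty
Zariski open subset of `(ℙ³)ⁿ` (over an infinite field `k`). -/
def HoldsInGeneralPosition (k : Type*) [Field k] {n : ℕ} (Q : (Fin n → P3 k) → Prop) : Prop :=
  ∃ F : MvPolynomial (Fin n × Fin 4) k, IsMultihomogeneous F ∧ F ≠ 0 ∧
    ∀ p : Fin n → P3 k, NonvanishingAt F p → Q p

/-- `g` is the Waldschmidt constant `γ(I(1^{×n}))` of `n` generic points of `ℙ³` over `k`: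
it is the Waldschmidt constant of the ideal of any `n` points of `ℙ³(K)`, `K` an extension field
of `k`, that are generic over `k`; and it is the limit of `a m / m`, where `a m` is the value of
`α(I^(m))` for `n` points of `ℙ³(k)` in general position. -/
def IsGenericWaldschmidtConstant (k : Type u) [Field k] (n : ℕ) (g : ℝ) : Prop :=
  (∀ (K : Type u) [Field K] [Algebra k K] (p : Fin n → P3 K),
    IsGenericTuple k p → HasWaldschmidtConstant (pointsIdeal p) g) ∧
  ∃ a : ℕ → ℕ,
    (∀ m : ℕ, HoldsInGeneralPosition k (fun p : Fin n → P3 k =>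
      initialDegree (symbolicPower (pointsIdeal p) m) = a m)) ∧
    Tendsto (fun m : ℕ => (a m : ℝ) / m) atTop (𝓝 g)

end

open MvPolynomial

universe u

/-! The inequality comes from the squaring map `x_i ↦ x_i ^ 2` of `ℙ³`, which has degree 8. Take `r`
points whose coordinates are independent variables. Their images under the 8 sign changes modulo a
common sign number `8 * r`, so a form of degree `d` vanishing to order `m` at `n ≥ 8 * r` generic
points specializes to one vanishing to order `m` at all of these. The product of its 16 sign
transforms has degree `16 * d`, vanishes to order `16 * m` at the `r` points, and is a polynomial in
the `x_i ^ 2`. It descends to a form of degree `8 * d` vanishing to order `16 * m` at the squared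
points, which are again generic. With `a_n(m)` the least degree for `n` generic points, `a_r(16 m) ≤
8 a_n(m)`. Division by `8 m` gives `2 γ_r ≤ γ_n` in the limit, and iteration gives the factor `2 ^
s` (`genericDegree_sixteen_mul_le`, `two_mul_lim_genericDegree_le`).

Existence of the constants rests on three facts. In characteristic zero, Euler's identity identifies
the forms in the symbolic power with those whose derivatives of order less than `m` vanish at the
points (`initialDegree_symbolicPower_pointsIdeal`). Having such a form of given degree is a rank
condition on a matrix polynomial in the coordinates, so the least degree is `genericDegree` off a
hypersurface defined over `k` (`exists_multihomogeneous_initialDegree_eq`). Multiplying forms makes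
`genericDegree` subadditive in `m`, so Fekete's lemma gives the limit. -/

/-! ### Order of vanishing through partial derivatives -/

theorem MvPolynomial.IsHomogeneous.eval_smul {σ S : Type*} [CommRing S] {t : ℕ}
    {f : MvPolynomial σ S} (hf : f.IsHomogeneous t) (c : S) (u : σ → S) :
    eval (c • u) f = c ^ t * eval u f := by
  rw [eval_eq, eval_eq, Finset.mul_sum]
  refine Finset.sum_congr rfl fun d hd => ?_
  have hd' : ∑ i ∈ d.support, d i = t := (hf.degree_eq_sum_deg_support hd).symm
  simp only [Pi.smul_apply, smul_eq_mul, mul_pow, Finset.prod_mul_distrib,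
    Finset.prod_pow_eq_pow_sum, hd']
  ring

theorem MvPolynomial.eval_bind₁ {σ τ S : Type*} [CommRing S] (u : τ → S)
    (g : σ → MvPolynomial τ S) (f : MvPolynomial σ S) :
    eval u (bind₁ g f) = eval (fun i => eval u (g i)) f := by
  exact eval₂Hom_bind₁ (RingHom.id S) u g f

theorem MvPolynomial.pderiv_bind₁ {σ S : Type*} [CommRing S] {g : σ → MvPolynomial σ S}
    (hg : ∀ i j, j ≠ i → pderiv i (g j) = 0) (i : σ) (f : MvPolynomial σ S) :
    pderiv i (bind₁ g f) = pderiv i (g i) * bind₁ g (pderiv i f) := by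
  classical
  induction f using MvPolynomial.induction_on with
  | C a => simp
  | add p q hp hq => simp [hp, hq, mul_add]
  | mul_X p j hp =>
    rcases eq_or_ne j i with rfl | h
    · simp only [map_mul, pderiv_mul, hp, bind₁_X_right, map_add, pderiv_X_self, mul_one]
      ring
    · simp only [map_mul, pderiv_mul, hp, bind₁_X_right, pderiv_X_of_ne h, hg i j h,
        mul_zero, add_zero]
      ring

/-- `f` and all its partial derivatives of order less than `m` vanish at `u`. -/
def VanishesToOrder {σ S : Type*} [CommRing S] (u : σ → S) : ℕ → MvPolynomial σ S → Prop
  | 0, _ => True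
  | m + 1, f => eval u f = 0 ∧ ∀ i, VanishesToOrder u m (pderiv i f)

namespace VanishesToOrder

variable {σ S : Type*} [CommRing S] {u : σ → S}

theorem of_succ {m : ℕ} {f : MvPolynomial σ S} (h : VanishesToOrder u (m + 1) f) :
    VanishesToOrder u m f := by
  induction m generalizing f with
  | zero => trivial
  | succ m ih => exact ⟨h.1, fun i => ih (h.2 i)⟩

theorem zero (u : σ → S) (m : ℕ) : VanishesToOrder u m (0 : MvPolynomial σ S) := by
  induction m with
  | zero => trivial
  | succ m ih => exact ⟨by simp, fun i => by simpa using ih⟩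

theorem add {m : ℕ} {f g : MvPolynomial σ S} (hf : VanishesToOrder u m f)
    (hg : VanishesToOrder u m g) : VanishesToOrder u m (f + g) := by
  induction m generalizing f g with
  | zero => trivial
  | succ m ih =>
    exact ⟨by simp [hf.1, hg.1], fun i => by simpa using ih (hf.2 i) (hg.2 i)⟩

theorem mul_left {m : ℕ} {f : MvPolynomial σ S} (g : MvPolynomial σ S)
    (hf : VanishesToOrder u m f) : VanishesToOrder u m (g * f) := by
  induction m generalizing f g with
  | zero => trivial
  | succ m ih =>
    refine ⟨by simp [hf.1], fun i => ?_⟩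
    rw [pderiv_mul]
    exact (ih _ hf.of_succ).add (ih _ (hf.2 i))

theorem mul_right {m : ℕ} {f : MvPolynomial σ S} (g : MvPolynomial σ S)
    (hf : VanishesToOrder u m f) : VanishesToOrder u m (f * g) :=
  mul_comm g f ▸ hf.mul_left g

theorem sum {ι : Type*} {m : ℕ} (s : Finset ι) {f : ι → MvPolynomial σ S}
    (hf : ∀ i ∈ s, VanishesToOrder u m (f i)) : VanishesToOrder u m (∑ i ∈ s, f i) := by
  classical
  induction s using Finset.induction_on with
  | empty => simpa using zero u m
  | insert a s ha ih =>
    rw [Finset.sum_insert ha]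
    exact (hf a (by simp)).add (ih fun i hi => hf i (by simp [hi]))

theorem mul {a b : ℕ} {f g : MvPolynomial σ S} (hf : VanishesToOrder u a f)
    (hg : VanishesToOrder u b g) : VanishesToOrder u (a + b) (f * g) := by
  induction hN : a + b generalizing a b f g with
  | zero => trivial
  | succ N ih =>
    match a, b, hf, hg with
    | 0, b, hf, hg => exact hN ▸ (Nat.zero_add b).symm ▸ hg.mul_left f
    | a + 1, 0, hf, hg => exact hN ▸ hf.mul_right g
    | a + 1, b + 1, hf, hg =>
      refine ⟨by simp [hf.1], fun i => ?_⟩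
      rw [pderiv_mul]
      exact (ih (hf.2 i) hg (by omega)).add (ih hf (hg.2 i) (by omega))

theorem prod {ι : Type*} (s : Finset ι) {m : ι → ℕ} {f : ι → MvPolynomial σ S}
    (hf : ∀ i ∈ s, VanishesToOrder u (m i) (f i)) :
    VanishesToOrder u (∑ i ∈ s, m i) (∏ i ∈ s, f i) := by
  classical
  induction s using Finset.induction_on with
  | empty => trivial
  | insert a s ha ih =>
    rw [Finset.prod_insert ha, Finset.sum_insert ha]
    exact (hf a (by simp)).mul (ih fun i hi => hf i (by simp [hi]))

theorem pow {a : ℕ} {f : MvPolynomial σ S} (hf : VanishesToOrder u a f) (m : ℕ) :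
    VanishesToOrder u (m * a) (f ^ m) := by
  simpa using prod (Finset.range m) (fun _ _ => hf)

/-- Induction on the order through `∂f * g = ∂(f * g) - f * ∂g`: the last term is controlled because
`f` already vanishes to one order less. -/
theorem of_mul [IsDomain S] {m : ℕ} {f g : MvPolynomial σ S} (hg : eval u g ≠ 0)
    (h : VanishesToOrder u m (f * g)) : VanishesToOrder u m f := by
  induction m generalizing f with
  | zero => trivial
  | succ m ih =>
    refine ⟨by simpa [hg] using h.1, fun i => ih ?_⟩
    have h1 := (h.2 i).add ((ih h.of_succ).mul_left (-pderiv i g))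
    rw [pderiv_mul] at h1
    convert h1 using 1
    ring

theorem smul_point {m t : ℕ} {f : MvPolynomial σ S} (hf : f.IsHomogeneous t)
    (h : VanishesToOrder u m f) (c : S) : VanishesToOrder (c • u) m f := by
  induction m generalizing f t with
  | zero => trivial
  | succ m ih =>
    refine ⟨?_, fun i => ih hf.pderiv (h.2 i)⟩
    rw [hf.eval_smul, h.1, mul_zero]

/-- If `g i` involves only the variable `i`, then substituting `g` preserves the order of
vanishing. -/
theorem bind₁ {m : ℕ} {f : MvPolynomial σ S} {g : σ → MvPolynomial σ S}
    (hg : ∀ i j, j ≠ i → pderiv i (g j) = 0)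
    (h : VanishesToOrder (fun i => eval u (g i)) m f) :
    VanishesToOrder u m (MvPolynomial.bind₁ g f) := by
  induction m generalizing f with
  | zero => trivial
  | succ m ih =>
    refine ⟨?_, fun i => ?_⟩
    · rw [eval_bind₁]; exact h.1
    · rw [pderiv_bind₁ hg]
      exact (ih (h.2 i)).mul_left _

/-- The substitution is étale at `u`: the factor produced by the chain rule is nonzero there and can
be cancelled. -/
theorem of_bind₁ [IsDomain S] {m : ℕ} {f : MvPolynomial σ S} {g : σ → MvPolynomial σ S}
    (hg : ∀ i j, j ≠ i → pderiv i (g j) = 0) (hu : ∀ i, eval u (pderiv i (g i)) ≠ 0)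
    (h : VanishesToOrder u m (MvPolynomial.bind₁ g f)) :
    VanishesToOrder (fun i => eval u (g i)) m f := by
  induction m generalizing f with
  | zero => trivial
  | succ m ih =>
    refine ⟨?_, fun i => ih ?_⟩
    · rw [← eval_bind₁]; exact h.1
    · have := h.2 i
      rw [pderiv_bind₁ hg, mul_comm] at this
      exact this.of_mul (hu i)

end VanishesToOrder

-- Powers of the ideal of a point

attribute [local instance] MvPolynomial.gradedAlgebra

/-- The ideal generated by the forms that vanish at `v`. -/
noncomputable def vanishingFormsIdeal {σ K : Type*} [Field K] (v : σ → K) : Ideal (MvPolynomial σ K) :=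
  Ideal.span {f | (∃ d : ℕ, f.IsHomogeneous d) ∧ eval v f = 0}

/-- The ideal of polynomials vanishing at `u` to order `m`. -/
noncomputable def vanishingOrderIdeal {σ S : Type*} [CommRing S] (u : σ → S) (m : ℕ) :
    Ideal (MvPolynomial σ S) where
  carrier := {f | VanishesToOrder u m f}
  add_mem' := VanishesToOrder.add
  zero_mem' := VanishesToOrder.zero u m
  smul_mem' g _ hf := hf.mul_left g

section DirectionalDerivative

variable {σ S : Type*} [CommRing S]

theorem MvPolynomial.pderiv_comm (i j : σ) (f : MvPolynomial σ S) :
    pderiv i (pderiv j f) = pderiv j (pderiv i f) := by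
  classical
  let D : σ → Derivation S (MvPolynomial σ S) (MvPolynomial σ S) := pderiv
  have h : ⁅D i, D j⁆ = 0 := by
    refine derivation_ext fun k => ?_
    rw [Derivation.commutator_apply]
    by_cases h1 : k = i <;> by_cases h2 : k = j <;>
      simp [D, pderiv_X, Pi.single_apply, h1, h2, apply_ite]
  have := DFunLike.congr_fun h f
  rwa [Derivation.commutator_apply, Derivation.zero_apply, sub_eq_zero] at this

variable [Fintype σ]

/-- Differentiating a form along the line through `v` loses no order of vanishing at `v`: by Euler,
the value there is `t * f(v)`. -/
theorem VanishesToOrder.sum_C_mul_pderiv {v : σ → S} {m t : ℕ} {f : MvPolynomial σ S}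
    (hf : f.IsHomogeneous t) (h : VanishesToOrder v m f) :
    VanishesToOrder v m (∑ i, C (v i) * pderiv i f) := by
  induction m generalizing f t with
  | zero => trivial
  | succ m ih =>
    refine ⟨?_, fun j => ?_⟩
    · have := congrArg (eval v) hf.sum_X_mul_pderiv
      simpa [h.1] using this
    · have := ih hf.pderiv (h.2 j)
      simpa [MvPolynomial.pderiv_comm j] using this

end DirectionalDerivative

namespace vanishingFormsIdeal

variable {σ K : Type*} [Field K] {v : σ → K}

theorem le_ker_eval (v : σ → K) : vanishingFormsIdeal v ≤ RingHom.ker (eval v) :=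
  Ideal.span_le.2 fun _ hf => hf.2

theorem mem_of_isHomogeneous {f : MvPolynomial σ K} {d : ℕ} (hf : f.IsHomogeneous d) :
    f ∈ vanishingFormsIdeal v ↔ eval v f = 0 :=
  ⟨fun h => le_ker_eval v h, fun h => Ideal.subset_span ⟨⟨d, hf⟩, h⟩⟩

theorem pow_le_vanishingOrderIdeal (v : σ → K) (m : ℕ) :
    vanishingFormsIdeal v ^ m ≤ vanishingOrderIdeal v m := by
  induction m with
  | zero => exact fun _ _ => trivial
  | succ m ih =>
    rw [pow_succ]
    refine Ideal.mul_le.2 fun f hf g hg => ?_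
    have hg' : VanishesToOrder v 1 g := ⟨le_ker_eval v hg, fun _ => trivial⟩
    exact VanishesToOrder.mul (ih hf) hg'

/-- Double induction, on the order and then on the degree. Euler's identity splits a multiple of `f`
into derivatives times linear forms vanishing at `v`, which gain one power, and a radial derivative,
which has the same order but lower degree. Characteristic zero allows division by the degree. -/
theorem mem_pow_iff [Fintype σ] [CharZero K] (hv : v ≠ 0) {f : MvPolynomial σ K} {t m : ℕ}
    (hf : f.IsHomogeneous t) :
    f ∈ vanishingFormsIdeal v ^ m ↔ VanishesToOrder v m f := by
  refine ⟨fun h => pow_le_vanishingOrderIdeal v m h, fun h => ?_⟩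
  obtain ⟨a, ha⟩ : ∃ a, v a ≠ 0 := Function.ne_iff.1 hv
  induction m generalizing f t with
  | zero => simp
  | succ m ihm =>
    induction t generalizing f with
    | zero =>
      rw [← totalDegree_zero_iff_isHomogeneous, totalDegree_eq_zero_iff_eq_C] at hf
      have h1 := h.1
      rw [hf, eval_C] at h1
      rw [hf, h1, C_0]
      exact zero_mem _
    | succ t iht =>
      have hD : ∑ i, C (v i) * pderiv i f ∈ vanishingFormsIdeal v ^ (m + 1) :=
        iht (IsHomogeneous.sum _ _ _ fun i _ => hf.pderiv.C_mul _) (h.sum_C_mul_pderiv hf)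
      have hL : ∀ i, C (v a) * X i - C (v i) * X a ∈ vanishingFormsIdeal v := fun i =>
        (mem_of_isHomogeneous (((isHomogeneous_X K i).C_mul _).sub
          ((isHomogeneous_X K a).C_mul _))).2 (by simp [mul_comm])
      have hS : ∑ i, (C (v a) * X i - C (v i) * X a) * pderiv i f ∈
          vanishingFormsIdeal v ^ (m + 1) := by
        refine sum_mem fun i _ => ?_
        rw [pow_succ']
        exact Ideal.mul_mem_mul (hL i) (ihm hf.pderiv (h.2 i))
      have key : C (v a * (t + 1 : ℕ)) * f =
          ∑ i, (C (v a) * X i - C (v i) * X a) * pderiv i f +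
            X a * ∑ i, C (v i) * pderiv i f := by
        have e := hf.sum_X_mul_pderiv
        rw [nsmul_eq_mul] at e
        rw [C_mul, mul_assoc, map_natCast, ← e, Finset.mul_sum, Finset.mul_sum,
          ← Finset.sum_add_distrib]
        exact Finset.sum_congr rfl fun i _ => by ring
      have hc : v a * (t + 1 : ℕ) ≠ 0 := mul_ne_zero ha (Nat.cast_ne_zero.2 (Nat.succ_ne_zero t))
      have : f = C (v a * (t + 1 : ℕ))⁻¹ * (C (v a * (t + 1 : ℕ)) * f) := by
        rw [← mul_assoc, ← C_mul, inv_mul_cancel₀ hc, C_1, one_mul]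
      rw [this, key]
      exact Ideal.mul_mem_left _ _ (add_mem hS (Ideal.mul_mem_left _ _ hD))

theorem isHomogeneous_pow (v : σ → K) (m : ℕ) :
    (vanishingFormsIdeal v ^ m).IsHomogeneous (homogeneousSubmodule σ K) := by
  induction m with
  | zero => rw [pow_zero, Ideal.one_eq_top]; exact Ideal.IsHomogeneous.top _
  | succ m ih =>
    rw [pow_succ]
    exact ih.mul (Ideal.homogeneous_span _ _ fun _ hf => hf.1)

theorem isHomogeneous (v : σ → K) :
    (vanishingFormsIdeal v).IsHomogeneous (homogeneousSubmodule σ K) :=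
  Ideal.homogeneous_span _ _ fun _ hf => hf.1

instance isPrime (v : σ → K) : (vanishingFormsIdeal v).IsPrime := by
  refine (isHomogeneous v).isPrime_of_homogeneous_mem_or_mem ?_ ?_
  · intro h
    have : (1 : MvPolynomial σ K) ∈ vanishingFormsIdeal v := h ▸ Submodule.mem_top
    simpa using le_ker_eval v this
  · rintro x y ⟨d, hx⟩ ⟨e, hy⟩ hxy
    have h := le_ker_eval v hxy
    rw [RingHom.mem_ker, map_mul, mul_eq_zero] at h
    exact h.imp (mem_of_isHomogeneous hx).2 (mem_of_isHomogeneous hy).2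

/-- Localizing at the point adds no forms to the power: some homogeneous component of `s` is nonzero
at `v`, and such a factor does not affect the order of vanishing. -/
theorem exists_mul_mem_pow_iff [Fintype σ] [CharZero K] (hv : v ≠ 0) {f : MvPolynomial σ K}
    {t m : ℕ} (hf : f.IsHomogeneous t) :
    (∃ s ∉ vanishingFormsIdeal v, s * f ∈ vanishingFormsIdeal v ^ m) ↔
      VanishesToOrder v m f := by
  constructor
  · rintro ⟨s, hs, h⟩
    obtain ⟨e, he⟩ : ∃ e, homogeneousComponent e s ∉ vanishingFormsIdeal v := by
      by_contra! hc
      apply hs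
      rw [← sum_homogeneousComponent s]
      exact sum_mem fun i _ => hc i
    have h1 := isHomogeneous_pow v m (e + t) h
    rw [DirectSum.coe_decompose_mul_add_of_right_mem _ ((mem_homogeneousSubmodule _ _).2 hf)] at h1
    have h2 : homogeneousComponent e s * f ∈ vanishingFormsIdeal v ^ m := by
      rw [← decomposition.decompose'_apply]
      exact h1
    have hE := homogeneousComponent_isHomogeneous e s
    rw [mem_pow_iff hv (hE.mul hf), mul_comm] at h2
    exact h2.of_mul fun h0 => he ((mem_of_isHomogeneous hE).2 h0)
  · intro h
    exact ⟨1, fun h1 => by simpa using le_ker_eval v h1,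
      by rw [one_mul]; exact (mem_pow_iff hv hf).2 h⟩

theorem mul_eq_mul_of_le {w : σ → K} (h : vanishingFormsIdeal v ≤ vanishingFormsIdeal w)
    (i j : σ) : v i * w j = v j * w i := by
  have : C (v i) * X j - C (v j) * X i ∈ vanishingFormsIdeal v :=
    (mem_of_isHomogeneous (((isHomogeneous_X K j).C_mul _).sub
      ((isHomogeneous_X K i).C_mul _))).2 (by simp [mul_comm])
  have := le_ker_eval w (h this)
  simpa [sub_eq_zero] using this

end vanishingFormsIdeal

/-! ### Symbolic powers of a finite intersection of primes -/

section SymbolicPower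

variable {R ι : Type*} [CommRing R] [Finite ι] {P : ι → Ideal R}

theorem Ideal.exists_notMem_mul_mem_iInf [hP : ∀ j, (P j).IsPrime]
    (h : ∀ i j, P i ≤ P j → P i = P j) (j : ι) :
    ∃ s ∉ P j, ∀ x ∈ P j, s * x ∈ ⨅ i, P i := by
  classical
  have := Fintype.ofFinite ι
  have hn : ¬ (Finset.univ.filter fun i => P i ≠ P j).inf P ≤ P j := by
    rw [(hP j).inf_le']
    rintro ⟨i, hi, hij⟩
    exact (Finset.mem_filter.1 hi).2 (h i j hij)
  obtain ⟨s, hs, hsj⟩ := Set.not_subset.1 hn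
  refine ⟨s, hsj, fun x hx => (Submodule.mem_iInf _).2 fun i => ?_⟩
  by_cases hi : P i = P j
  · exact hi ▸ Ideal.mul_mem_left _ _ hx
  · exact Ideal.mul_mem_right _ _ ((Submodule.mem_finsetInf.1 hs) i (by simp [hi]))

variable [IsNoetherianRing R]

theorem mem_associatedPrimes_quotient_iInf [hP : ∀ j, (P j).IsPrime]
    (h : ∀ i j, P i ≤ P j → P i = P j) {Q : Ideal R} :
    Q ∈ associatedPrimes R (R ⧸ ⨅ i, P i) ↔ ∃ j, Q = P j := by
  classical
  have := Fintype.ofFinite ι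
  have hmem : ∀ a y : R, a ∈ (⊥ : Submodule R (R ⧸ ⨅ i, P i)).colon
      {(Ideal.Quotient.mk (⨅ i, P i) y)} ↔ ∀ i, a * y ∈ P i := by
    intro a y
    rw [Submodule.mem_colon_singleton, Submodule.mem_bot, Algebra.smul_def,
      Ideal.Quotient.algebraMap_eq, ← map_mul, Ideal.Quotient.eq_zero_iff_mem,
      Submodule.mem_iInf]
  rw [AssociatedPrimes.mem_iff, isAssociatedPrime_iff]
  constructor
  · rintro ⟨hQ, x, hx⟩
    obtain ⟨y, rfl⟩ := Ideal.Quotient.mk_surjective x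
    have hle : (Finset.univ.filter fun i => y ∉ P i).inf P ≤ Q := by
      intro a ha
      rw [hx, hmem]
      intro i
      by_cases hy : y ∈ P i
      · exact Ideal.mul_mem_left _ _ hy
      · exact Ideal.mul_mem_right _ _ ((Submodule.mem_finsetInf.1 ha) i (by simp [hy]))
    obtain ⟨j, hj, hjQ⟩ := hQ.inf_le'.1 hle
    refine ⟨j, le_antisymm (fun a ha => ?_) hjQ⟩
    rw [hx, hmem] at ha
    exact ((hP j).mem_or_mem (ha j)).resolve_right (Finset.mem_filter.1 hj).2
  · rintro ⟨j, rfl⟩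
    obtain ⟨s, hs, hsx⟩ := Ideal.exists_notMem_mul_mem_iInf h j
    refine ⟨hP j, Ideal.Quotient.mk _ s, ?_⟩
    ext a
    rw [hmem]
    constructor
    · intro ha i
      rw [mul_comm]
      exact (Submodule.mem_iInf _).1 (hsx a ha) i
    · intro ha
      exact ((hP j).mem_or_mem (ha j)).resolve_right hs

/-- Near `P j` the intersection agrees with `P j`: some `r ∉ P j` multiplies `P j` into it, hence `r
^ m` multiplies `P j ^ m` into its `m`-th power. The hypothesis `h` allows repeated primes, as for
coinciding points. -/
theorem mem_symbolicPower_iInf_iff [hP : ∀ j, (P j).IsPrime]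
    (h : ∀ i j, P i ≤ P j → P i = P j) {m : ℕ} {f : R} :
    f ∈ symbolicPower (⨅ i, P i) m ↔ ∀ j, ∃ s ∉ P j, s * f ∈ P j ^ m := by
  have key : f ∈ symbolicPower (⨅ i, P i) m ↔
      ∀ j, ∃ s ∉ P j, s * f ∈ (⨅ i, P i) ^ m := by
    simp only [symbolicPower, Submodule.mem_iInf, Ideal.mem_comap]
    constructor
    · intro hf j
      have := hf (P j) ((mem_associatedPrimes_quotient_iInf h).2 ⟨j, rfl⟩)
      rwa [IsLocalization.algebraMap_mem_map_algebraMap_iff (P j).primeCompl] at this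
    · intro hf Q hQ
      obtain ⟨j, rfl⟩ := (mem_associatedPrimes_quotient_iInf h).1 hQ
      rw [IsLocalization.algebraMap_mem_map_algebraMap_iff (P j).primeCompl]
      exact hf j
  rw [key]
  refine forall_congr' fun j => ⟨?_, ?_⟩
  · rintro ⟨s, hs, hsf⟩
    exact ⟨s, hs, Ideal.pow_right_mono (iInf_le P j) m hsf⟩
  · rintro ⟨s, hs, hsf⟩
    obtain ⟨r, hr, hrx⟩ := Ideal.exists_notMem_mul_mem_iInf h j
    refine ⟨r ^ m * s, fun hc => ?_, ?_⟩
    · exact ((hP j).mem_or_mem hc).elim (fun h1 => hr ((hP j).mem_of_pow_mem m h1)) hs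
    · have h1 : Ideal.span {r} * P j ≤ ⨅ i, P i :=
        Ideal.span_singleton_mul_le_iff.2 hrx
      have h2 := Ideal.pow_right_mono h1 m
      rw [mul_pow, Ideal.span_singleton_pow] at h2
      rw [mul_assoc]
      exact h2 (Ideal.mul_mem_mul (Ideal.mem_span_singleton_self _) hsf)

end SymbolicPower

/-- There is a nonzero form of degree `t` that vanishes to order `m` at all the points `v j`. -/
def ExistsForm {ι σ S : Type*} [CommRing S] (v : ι → σ → S) (m t : ℕ) : Prop :=
  ∃ f : MvPolynomial σ S, f ≠ 0 ∧ f.IsHomogeneous t ∧ ∀ j, VanishesToOrder (v j) m f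

theorem initialDegree_symbolicPower_pointsIdeal {K : Type*} [Field K] [CharZero K] {n : ℕ}
    (p : Fin n → P3 K) (m : ℕ) :
    initialDegree (symbolicPower (pointsIdeal p) m) =
      sInf {t | ExistsForm (fun j => (p j).rep) m t} := by
  have hI : pointsIdeal p = ⨅ j, vanishingFormsIdeal (p j).rep := by
    simp only [pointsIdeal, fatPointsIdeal, pow_one]
    rfl
  have hinc : ∀ i j, vanishingFormsIdeal (p i).rep ≤ vanishingFormsIdeal (p j).rep →
      vanishingFormsIdeal (p i).rep = vanishingFormsIdeal (p j).rep := by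
    intro i j hij
    have hpij : p i = p j := by
      obtain ⟨a, ha⟩ := Function.ne_iff.1 (p i).rep_nonzero
      obtain ⟨b, hb⟩ := Function.ne_iff.1 (p j).rep_nonzero
      rw [← (p i).mk_rep, ← (p j).mk_rep, Projectivization.mk_eq_mk_iff']
      have hab := vanishingFormsIdeal.mul_eq_mul_of_le hij
      refine ⟨(p i).rep b / (p j).rep b, funext fun c => ?_⟩
      rw [Pi.smul_apply, smul_eq_mul, div_mul_eq_mul_div]
      exact (div_eq_iff hb).2 (hab b c)
    rw [hpij]
  unfold initialDegree
  congr 1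
  ext t
  simp only [Set.mem_ofPred_eq, ExistsForm]
  refine exists_congr fun f => ?_
  rw [hI, mem_symbolicPower_iInf_iff hinc]
  constructor
  · rintro ⟨h1, h2, h3⟩
    exact ⟨h2, h3, fun j =>
      (vanishingFormsIdeal.exists_mul_mem_pow_iff (p j).rep_nonzero h3).1 (h1 j)⟩
  · rintro ⟨h2, h3, h1⟩
    exact ⟨fun j => (vanishingFormsIdeal.exists_mul_mem_pow_iff (p j).rep_nonzero h3).2 (h1 j),
      h2, h3⟩

/-! ### Left inverses of injective matrices -/

section LinearAlgebra

variable {m n : Type*} [Fintype m] [Fintype n] [DecidableEq m] [DecidableEq n]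

theorem Matrix.exists_leftInverse_of_mulVec_eq_zero {K : Type*} [Field K] {A : Matrix m n K}
    (hA : ∀ c, A.mulVec c = 0 → c = 0) : ∃ B : Matrix n m K, B * A = 1 := by
  obtain ⟨g, hg⟩ := LinearMap.exists_leftInverse_of_injective (Matrix.toLin' A)
    (LinearMap.ker_eq_bot'.2 hA)
  refine ⟨LinearMap.toMatrix' g, ?_⟩
  rw [← LinearMap.toMatrix'_id, ← hg, LinearMap.toMatrix'_comp, LinearMap.toMatrix'_toLin']

/-- `F` is a common denominator of a left inverse over the fraction field. Wherever `F` specializes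
to a nonzero value, the matrix stays injective. -/
theorem Matrix.exists_mul_eq_smul_one_of_mulVec_eq_zero {D : Type*} [CommRing D] [IsDomain D]
    {A : Matrix m n D} (hA : ∀ c, A.mulVec c = 0 → c = 0) :
    ∃ F : D, F ≠ 0 ∧ ∃ B : Matrix n m D, B * A = F • 1 := by
  let φ := algebraMap D (FractionRing D)
  have hφ : Function.Injective φ := IsFractionRing.injective D (FractionRing D)
  have hA' : ∀ c, (A.map φ).mulVec c = 0 → c = 0 := by
    intro c hc
    obtain ⟨b, hb⟩ := IsLocalization.exist_integer_multiples_of_finite (nonZeroDivisors D) c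
    choose c' hc' using hb
    have hb0 : φ b ≠ 0 := fun h => nonZeroDivisors.coe_ne_zero b (hφ (by rw [h, map_zero]))
    have h1 : φ ∘ c' = φ b • c := by
      funext i
      rw [Function.comp_apply, hc' i, Pi.smul_apply, Algebra.smul_def]
      rfl
    have h2 : c' = 0 := by
      refine hA c' (funext fun i => hφ ?_)
      rw [RingHom.map_mulVec, h1, Matrix.mulVec_smul, hc]
      simp
    have h3 : φ b • c = 0 := by rw [← h1, h2]; ext; simp
    exact (smul_eq_zero.1 h3).resolve_left hb0
  obtain ⟨B, hB⟩ := Matrix.exists_leftInverse_of_mulVec_eq_zero hA'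
  obtain ⟨b, hb⟩ := IsLocalization.exist_integer_multiples_of_finite (nonZeroDivisors D)
    (fun x : n × m => B x.1 x.2)
  choose B' hB' using hb
  refine ⟨b, nonZeroDivisors.coe_ne_zero b, Matrix.of fun i j => B' (i, j), ?_⟩
  apply Matrix.map_injective hφ
  dsimp only
  rw [Matrix.map_mul]
  have h1 : (Matrix.of fun i j => B' (i, j)).map φ = φ b • B := by
    ext i j
    rw [Matrix.map_apply, Matrix.of_apply, hB', Matrix.smul_apply, Algebra.smul_def]
    rfl
  rw [h1, Matrix.smul_mul, hB]
  ext i j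
  simp [Matrix.one_apply, apply_ite φ]

end LinearAlgebra

/-! ### Vanishing conditions as a matrix -/

section JetMatrix

variable {ι σ S T : Type*} [CommRing S] [CommRing T]

/-- The iterated partial derivative along a list of variables. -/
noncomputable def iteratedPderiv : List σ → MvPolynomial σ S →ₗ[S] MvPolynomial σ S
  | [] => LinearMap.id
  | i :: l => iteratedPderiv l ∘ₗ (pderiv i).toLinearMap

theorem vanishesToOrder_iff_iteratedPderiv {u : σ → S} {m : ℕ} {f : MvPolynomial σ S} :
    VanishesToOrder u m f ↔ ∀ l : List σ, l.length < m → eval u (iteratedPderiv l f) = 0 := by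
  induction m generalizing f with
  | zero => exact ⟨fun _ l h => absurd h (Nat.not_lt_zero _), fun _ => trivial⟩
  | succ m ih =>
    constructor
    · rintro ⟨h0, h1⟩ l hl
      cases l with
      | nil => exact h0
      | cons i l => exact ih.1 (h1 i) l (Nat.lt_of_succ_lt_succ hl)
    · intro h
      exact ⟨h [] (Nat.succ_pos m), fun i => ih.2 fun l hl => h (i :: l) (Nat.succ_lt_succ hl)⟩

theorem map_iteratedPderiv (φ : S →+* T) (l : List σ) (f : MvPolynomial σ S) :
    map φ (iteratedPderiv l f) = iteratedPderiv l (map φ f) := by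
  induction l generalizing f with
  | nil => rfl
  | cons i l ih =>
    change map φ (iteratedPderiv l (pderiv i f)) = iteratedPderiv l (pderiv i (map φ f))
    rw [ih, pderiv_map]

/-- The matrix of the linear map that sends a form of degree `t` to its derivatives of order less
than `m` at the points `v j`. -/
noncomputable def jetMatrix (v : ι → σ → S) (m t : ℕ) :
    Matrix (ι × {l : List σ // l.length < m}) {a : σ →₀ ℕ // a.degree = t} S :=
  Matrix.of fun r a => eval (v r.1) (iteratedPderiv r.2.1 (monomial a.1 1))

theorem jetMatrix_map (φ : S →+* T) (v : ι → σ → S) (m t : ℕ) :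
    (jetMatrix v m t).map φ = jetMatrix (fun j i => φ (v j i)) m t := by
  ext r a
  have h : (monomial a.1 (1 : T)) = map φ (monomial a.1 (1 : S)) := by simp
  simp only [jetMatrix, Matrix.map_apply, Matrix.of_apply]
  rw [h, ← map_iteratedPderiv, eval_map]
  exact eval₂_comp_left φ (RingHom.id S) (v r.1) _

variable [Finite σ]

noncomputable instance (m : ℕ) : Fintype {l : List σ // l.length < m} :=
  (List.finite_length_lt σ m).fintype

noncomputable instance (t : ℕ) : Fintype {a : σ →₀ ℕ // a.degree = t} :=
  ((Finsupp.finite_of_degree_le t).subset fun _ h => le_of_eq h).fintype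

theorem existsForm_iff_jetMatrix {v : ι → σ → S} {m t : ℕ} :
    ExistsForm v m t ↔ ∃ c, c ≠ 0 ∧ (jetMatrix v m t).mulVec c = 0 := by
  classical
  let form : ({a : σ →₀ ℕ // a.degree = t} → S) → MvPolynomial σ S :=
    fun c => ∑ a, monomial a.1 (c a)
  have hcoeff : ∀ c a, coeff a.1 (form c) = c a := by
    intro c a
    simp only [form, coeff_sum, coeff_monomial, Subtype.coe_inj]
    simp
  have hhom : ∀ c, (form c).IsHomogeneous t := fun c =>
    IsHomogeneous.sum _ _ _ fun a _ => isHomogeneous_monomial _ a.2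
  have hmul : ∀ c r, (jetMatrix v m t).mulVec c r =
      eval (v r.1) (iteratedPderiv r.2.1 (form c)) := by
    intro c r
    simp only [Matrix.mulVec, dotProduct, jetMatrix, Matrix.of_apply, form, map_sum]
    refine Finset.sum_congr rfl fun a _ => ?_
    have : monomial a.1 (c a) = c a • monomial a.1 (1 : S) := by
      rw [smul_monomial, smul_eq_mul, mul_one]
    rw [this, map_smul, smul_eval, mul_comm]
  have hvan : ∀ c, (jetMatrix v m t).mulVec c = 0 ↔ ∀ j, VanishesToOrder (v j) m (form c) := by
    intro c
    simp only [vanishesToOrder_iff_iteratedPderiv, funext_iff, hmul]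
    exact ⟨fun h j l hl => h (j, ⟨l, hl⟩), fun h r => h r.1 r.2.1 r.2.2⟩
  constructor
  · rintro ⟨f, hf0, hf, h⟩
    have hfc : form (fun a => coeff a.1 f) = f := by
      ext a
      by_cases ha : a.degree = t
      · exact hcoeff _ ⟨a, ha⟩
      · rw [(hhom _).coeff_eq_zero ha, hf.coeff_eq_zero ha]
    refine ⟨fun a => coeff a.1 f, fun h0 => hf0 ?_, (hvan _).2 (by rwa [hfc])⟩
    rw [← hfc, h0]
    simp [form]
  · rintro ⟨c, hc, h⟩
    refine ⟨form c, fun h0 => hc (funext fun a => ?_), hhom c, (hvan c).1 h⟩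
    rw [← hcoeff c a, h0, coeff_zero, Pi.zero_apply]

end JetMatrix

/-! ### Universal points and semicontinuity -/

section GenericPoints

/-- The tuple of points whose coordinates are independent variables over `k`. -/
noncomputable def universalPoint (k ι σ : Type*) [CommRing k] : ι → σ → MvPolynomial (ι × σ) k :=
  fun j i => X (j, i)

variable {ι σ : Type*} [Finite ι] [Finite σ]

/-- Rank can only drop under specialization. A universal form may itself specialize to zero, so the
argument uses matrices: a left inverse `B` at `v` would make the determinant of `B` times the
universal matrix equal to 1 at `v`, although that matrix has a kernel. -/
theorem ExistsForm.specialize {k K : Type*} [Field k] [Field K] [Algebra k K] {m t : ℕ}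
    (h : ExistsForm (universalPoint k ι σ) m t) (v : ι → σ → K) : ExistsForm v m t := by
  classical
  have := Fintype.ofFinite ι
  rw [existsForm_iff_jetMatrix] at h ⊢
  obtain ⟨c, hc0, hc⟩ := h
  by_contra! hv
  obtain ⟨B, hB⟩ := Matrix.exists_leftInverse_of_mulVec_eq_zero
    (A := jetMatrix v m t) fun c h => by_contra fun h0 => hv c h0 h
  let φ : MvPolynomial (ι × σ) k →+* MvPolynomial (ι × σ) K := map (algebraMap k K)
  have hφ : Function.Injective φ := map_injective _ (algebraMap k K).injective
  let A' := jetMatrix (universalPoint K ι σ) m t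
  have hA' : (jetMatrix (universalPoint k ι σ) m t).map φ = A' := by
    rw [jetMatrix_map]
    congr 1
    funext j i
    exact map_X _ _
  have hA'v : A'.map (eval fun x => v x.1 x.2) = jetMatrix v m t := by
    rw [jetMatrix_map]
    congr 1
    funext j i
    exact eval_X _
  let M := B.map (C : K →+* MvPolynomial (ι × σ) K) * A'
  have hdet : M.det ≠ 0 := by
    intro h0
    have h1 : M.map (eval fun x => v x.1 x.2) = 1 := by
      rw [Matrix.map_mul, hA'v, Matrix.map_map, ← hB]
      congr 1
      ext i j
      simp
    have h2 := RingHom.map_det (eval fun x : ι × σ => v x.1 x.2) M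
    rw [RingHom.mapMatrix_apply, h1, h0, map_zero, Matrix.det_one] at h2
    exact zero_ne_one h2
  apply hdet
  rw [← Matrix.exists_mulVec_eq_zero_iff]
  refine ⟨φ ∘ c, fun h0 => hc0 (funext fun a => hφ ?_), ?_⟩
  · rw [Pi.zero_apply, map_zero]; exact congrFun h0 a
  · rw [← Matrix.mulVec_mulVec, ← hA']
    have : ((jetMatrix (universalPoint k ι σ) m t).map φ).mulVec (φ ∘ c) = 0 := by
      funext r
      rw [← RingHom.map_mulVec, hc]
      simp
    rw [this, Matrix.mulVec_zero]

theorem exists_ne_zero_forall_not_existsForm {k : Type u} [Field k] {m t : ℕ}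
    (h : ¬ ExistsForm (universalPoint k ι σ) m t) :
    ∃ F : MvPolynomial (ι × σ) k, F ≠ 0 ∧
      ∀ (K : Type u) [Field K] [Algebra k K] (v : ι → σ → K),
        aeval (fun x : ι × σ => v x.1 x.2) F ≠ 0 → ¬ ExistsForm v m t := by
  classical
  have := Fintype.ofFinite ι
  rw [existsForm_iff_jetMatrix] at h
  push Not at h
  obtain ⟨F, hF, B, hB⟩ := Matrix.exists_mul_eq_smul_one_of_mulVec_eq_zero
    (A := jetMatrix (universalPoint k ι σ) m t) fun c h1 => by_contra fun h0 => h c h0 h1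
  refine ⟨F, hF, fun K _ _ v hv => ?_⟩
  let φ : MvPolynomial (ι × σ) k →+* K :=
    (aeval fun x : ι × σ => v x.1 x.2 : MvPolynomial (ι × σ) k →ₐ[k] K)
  have hA : (jetMatrix (universalPoint k ι σ) m t).map φ = jetMatrix v m t := by
    rw [jetMatrix_map]
    congr 1
    funext j i
    exact aeval_X _ _
  rw [existsForm_iff_jetMatrix]
  rintro ⟨c, hc0, hc⟩
  have h1 := congrArg (fun M => M.map φ) hB
  simp only [Matrix.map_mul, hA] at h1
  let E : Matrix {a : σ →₀ ℕ // a.degree = t} {a : σ →₀ ℕ // a.degree = t}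
    (MvPolynomial (ι × σ) k) := F • 1
  have h2 : (E.map φ).mulVec c = 0 := by
    rw [← h1, ← Matrix.mulVec_mulVec, hc, Matrix.mulVec_zero]
  have h3 : E.map φ = φ F • 1 := by
    ext i j
    simp [E, Matrix.one_apply, apply_ite φ]
  rw [h3, Matrix.smul_mulVec, Matrix.one_mulVec] at h2
  exact hc0 ((smul_eq_zero.1 h2).resolve_left hv)

end GenericPoints

/-! ### Sign changes and descent along the squaring map -/

section Squaring

theorem MvPolynomial.coeff_bind₁_C_mul_X {σ S : Type*} [CommRing S] [Fintype σ] (c : σ → S)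
    (f : MvPolynomial σ S) (a : σ →₀ ℕ) :
    coeff a (bind₁ (fun i => C (c i) * X i) f) = (∏ i, c i ^ a i) * coeff a f := by
  classical
  induction f using MvPolynomial.induction_on' with
  | add p q hp hq => simp [hp, hq, mul_add]
  | monomial b r =>
    have h : bind₁ (fun i => C (c i) * X i) (monomial b r) =
        C (∏ i, c i ^ b i) * monomial b r := by
      rw [bind₁_monomial, monomial_eq (s := b) (a := r),
        Finsupp.prod_fintype b _ fun i => pow_zero (X i), map_prod]
      rw [Finset.prod_subset b.support.subset_univ fun i _ hi => by
        rw [Finsupp.notMem_support_iff.1 hi, pow_zero]]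
      simp only [mul_pow, Finset.prod_mul_distrib, map_pow]
      ring
    rw [h, coeff_C_mul, coeff_monomial]
    split_ifs with hab
    · rw [hab]
    · simp

theorem MvPolynomial.exists_expand_two_eq {σ S : Type*} [CommRing S] {f : MvPolynomial σ S}
    (hf : ∀ a, coeff a f ≠ 0 → ∀ i, Even (a i)) : ∃ g, expand 2 g = f := by
  refine ⟨∑ a ∈ f.support, monomial (a.mapRange (· / 2) rfl) (coeff a f), ?_⟩
  conv_rhs => rw [f.as_sum]
  rw [map_sum]
  refine Finset.sum_congr rfl fun a ha => ?_
  have h : 2 • a.mapRange (· / 2) rfl = a := Finsupp.ext fun i => by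
    simpa using Nat.mul_div_cancel' (hf a (mem_support_iff.1 ha) i).two_dvd
  rw [expand_monomial, h]

/-- The point obtained from `u` by changing the signs of the coordinates. -/
def changeSigns {σ K : Type*} [CommRing K] (e : σ → ℤˣ) (u : σ → K) : σ → K :=
  fun i => ((e i : ℤ) : K) * u i

/-- The polynomial obtained from `f` by changing the signs of the variables. -/
noncomputable def flipSigns {σ K : Type*} [CommRing K] (e : σ → ℤˣ) :
    MvPolynomial σ K →ₐ[K] MvPolynomial σ K :=
  bind₁ fun i => C ((e i : ℤ) : K) * X i

variable {σ K : Type*} [Field K]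

theorem flipSigns_flipSigns (e e' : σ → ℤˣ) (f : MvPolynomial σ K) :
    flipSigns e (flipSigns e' f) = flipSigns (e * e') f := by
  simp only [flipSigns, bind₁_bind₁]
  congr 2
  funext i
  simp [mul_left_comm, mul_assoc]

theorem flipSigns_one (f : MvPolynomial σ K) : flipSigns 1 f = f := by
  simp [flipSigns]

theorem VanishesToOrder.flipSigns {u : σ → K} {e : σ → ℤˣ} {m : ℕ} {f : MvPolynomial σ K}
    (h : VanishesToOrder (changeSigns e u) m f) : VanishesToOrder u m (flipSigns e f) := by
  classical
  refine VanishesToOrder.bind₁ (fun i j hij => ?_) ?_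
  · rw [pderiv_C_mul, pderiv_X_of_ne hij, mul_zero]
  · convert h using 2 with i
    simp [changeSigns]

/-- The product of all the polynomials obtained from `f` by changing the signs of variables. -/
noncomputable def signNorm [Fintype σ] [DecidableEq σ] (f : MvPolynomial σ K) :
    MvPolynomial σ K :=
  ∏ e : σ → ℤˣ, flipSigns e f

variable [Fintype σ] [DecidableEq σ] [CharZero K]

/-- The product over the whole sign group is invariant, and flipping only the sign of `X i` negates
the coefficients of monomials odd in `X i`, so these vanish. -/
theorem exists_expand_two_eq_signNorm (f : MvPolynomial σ K) :
    ∃ g, expand 2 g = signNorm f := by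
  have hinv : ∀ e : σ → ℤˣ, flipSigns e (signNorm f) = signNorm f := by
    intro e
    simp only [signNorm, map_prod, flipSigns_flipSigns]
    exact Fintype.prod_equiv (Equiv.mulLeft e) _ _ fun _ => rfl
  refine exists_expand_two_eq fun a ha i => ?_
  by_contra hodd
  rw [Nat.not_even_iff_odd] at hodd
  have h := congrArg (coeff a) (hinv (Function.update 1 i (-1)))
  rw [flipSigns, coeff_bind₁_C_mul_X, Finset.prod_eq_single i] at h
  · simp only [Function.update_self, Units.val_neg, Units.val_one, Int.cast_neg, Int.cast_one,
      hodd.neg_one_pow, neg_mul, one_mul] at h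
    exact ha (self_eq_neg.1 h.symm)
  · intro j _ hj
    simp [Function.update_of_ne hj]
  · simp

/-- The sign norm of `f` collects order `m` from each sign change. It descends with the full order
because squaring is étale off the coordinate hyperplanes, which `hu` ensures. -/
theorem existsForm_sq {ι : Type*} {u : ι → σ → K} (hu : ∀ j i, u j i ≠ 0) {m d t : ℕ}
    {f : MvPolynomial σ K} (hf0 : f ≠ 0) (hf : f.IsHomogeneous d) (ht : 2 ^ Fintype.card σ * d = 2 * t)
    (h : ∀ j e, VanishesToOrder (changeSigns e (u j)) m f) :
    ExistsForm (fun j i => u j i ^ 2) (2 ^ Fintype.card σ * m) t := by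
  obtain ⟨g, hg⟩ := exists_expand_two_eq_signNorm f
  have hcard : Fintype.card (σ → ℤˣ) = 2 ^ Fintype.card σ := by simp
  have hN0 : signNorm f ≠ 0 := by
    refine Finset.prod_ne_zero_iff.2 fun e _ h0 => hf0 ?_
    rw [← flipSigns_one f, ← inv_mul_cancel e, ← flipSigns_flipSigns, h0, map_zero]
  have hN : (signNorm f).IsHomogeneous (2 * t) := by
    have : ∀ e : σ → ℤˣ, (flipSigns e f).IsHomogeneous (1 * d) := fun e =>
      hf.aeval _ fun i => (isHomogeneous_X K i).C_mul _
    have := IsHomogeneous.prod Finset.univ (fun e : σ → ℤˣ => flipSigns e f) _ fun e _ => this e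
    rwa [Finset.sum_const, Finset.card_univ, hcard, one_mul, smul_eq_mul, ht] at this
  have hNv : ∀ j, VanishesToOrder (u j) (2 ^ Fintype.card σ * m) (signNorm f) := by
    intro j
    have := VanishesToOrder.prod Finset.univ fun (e : σ → ℤˣ) _ => (h j e).flipSigns
    rwa [Finset.sum_const, Finset.card_univ, hcard, smul_eq_mul] at this
  refine ⟨g, fun h0 => hN0 (by rw [← hg, h0, map_zero]), fun a ha => ?_, fun j => ?_⟩
  · have h1 : coeff (2 • a) (signNorm f) ≠ 0 := by rwa [← hg, coeff_expand_smul 2 two_ne_zero]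
    have h2 := hN h1
    rw [map_nsmul, smul_eq_mul] at h2
    exact Nat.eq_of_mul_eq_mul_left two_pos h2
  · have h1 := hNv j
    rw [← hg] at h1
    have h2 := VanishesToOrder.of_bind₁ (g := fun i => X i ^ 2) (fun i k hik => ?_) (fun i => ?_) h1
    · simpa using h2
    · rw [pderiv_pow, pderiv_X_of_ne hik, mul_zero]
    · simpa [pderiv_pow] using hu j i

end Squaring

/-! ### Passage to multihomogeneous conditions -/

section Multihomogeneous

theorem exists_multihomogeneous_forall_smul {k : Type u} [Field k] [CharZero k] {n : ℕ}
    {F : MvPolynomial (Fin n × Fin 4) k} (hF : F ≠ 0) :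
    ∃ G : MvPolynomial (Fin n × Fin 4) k, IsMultihomogeneous G ∧ G ≠ 0 ∧
      ∀ (K : Type u) [Field K] [Algebra k K] (v : Fin n → Fin 4 → K),
        aeval (fun x : Fin n × Fin 4 => v x.1 x.2) G ≠ 0 →
        ∃ c : Fin n → K, aeval (fun x : Fin n × Fin 4 => (c x.1 • v x.1) x.2) F ≠ 0 := by
  classical
  obtain ⟨d, hd⟩ := exists_coeff_ne_zero hF
  let w : Fin n × Fin 4 → Fin n → ℕ := fun x => Pi.single x.1 1
  have hG : (weightedHomogeneousComponent w (Finsupp.weight w d) F) ≠ 0 := by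
    intro h0
    apply hd
    have := coeff_weightedHomogeneousComponent (w := w) (Finsupp.weight w d) F d
    rwa [h0, if_pos rfl, coeff_zero, eq_comm] at this
  refine ⟨_, ⟨_, weightedHomogeneousComponent_isWeightedHomogeneous _ _⟩, hG,
    fun K _ _ v hv => ?_⟩
  have : CharZero K := charZero_of_injective_algebraMap (algebraMap k K).injective
  -- `H F` is `F` at the points scaled by independent variables; its coefficients are the values at
  -- `v` of the multihomogeneous components of `F`. If one is nonzero, some scaling works, since `K`
  -- is infinite.
  let H : MvPolynomial (Fin n × Fin 4) k →ₐ[k] MvPolynomial (Fin n) K :=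
    aeval fun x => C (v x.1 x.2) * X x.1
  have hcoeff : ∀ (e : Fin n → ℕ) (f : MvPolynomial (Fin n × Fin 4) k),
      coeff (Finsupp.equivFunOnFinite.symm e) (H f) =
        aeval (fun x : Fin n × Fin 4 => v x.1 x.2) (weightedHomogeneousComponent w e f) := by
    intro e f
    induction f using MvPolynomial.induction_on' with
    | add p q hp hq => simp [hp, hq]
    | monomial b r =>
      have h1 : H (monomial b r) = monomial (Finsupp.equivFunOnFinite.symm (Finsupp.weight w b))
          (aeval (fun x : Fin n × Fin 4 => v x.1 x.2) (monomial b r)) := by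
        have h2 : (Finsupp.equivFunOnFinite.symm (Finsupp.weight w b)) =
            ∑ x, b x • Finsupp.single x.1 1 := by
          ext j
          rw [Finsupp.weight_apply, Finsupp.sum_fintype b (fun i c => c • w i) fun _ => zero_smul _ _]
          simp [w, Finsupp.single_apply, Pi.single_apply, eq_comm]
        rw [h2]
        simp only [H, aeval_monomial]
        rw [Finsupp.prod_fintype _ _ fun _ => pow_zero _,
          Finsupp.prod_fintype _ _ fun _ => pow_zero _]
        simp only [mul_pow, Finset.prod_mul_distrib]
        rw [← mul_one (algebraMap k K r * _), ← C_mul_monomial, monomial_sum_one]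
        simp only [map_mul, map_prod, map_pow, X_pow_eq_monomial, mul_assoc,
          IsScalarTower.algebraMap_apply k K (MvPolynomial (Fin n) K), algebraMap_eq]
        simp
      rw [h1, coeff_monomial, weightedHomogeneousComponent_of_mem (n := Finsupp.weight w b)
        (isWeightedHomogeneous_monomial w b r rfl)]
      simp only [EmbeddingLike.apply_eq_iff_eq, eq_comm (a := e)]
      split_ifs <;> simp
  have hH : H F ≠ 0 := by
    intro h0
    apply hv
    rw [← hcoeff, h0, coeff_zero]
  by_contra! hc
  refine hH (MvPolynomial.funext fun c => ?_)
  rw [map_zero, ← hc c]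
  change ((aeval c : MvPolynomial (Fin n) K →ₐ[K] K).restrictScalars k).comp H F = _
  congr 1
  ext x
  simp [H, mul_comm]

end Multihomogeneous

/-! ### Products and rescaling -/

section ExistsForm

variable {ι σ S : Type*} [CommRing S] [IsDomain S] {v : ι → σ → S} {m t : ℕ}

theorem ExistsForm.mul {m' t' : ℕ} (h : ExistsForm v m t) (h' : ExistsForm v m' t') :
    ExistsForm v (m + m') (t + t') := by
  obtain ⟨f, hf0, hf, hfv⟩ := h
  obtain ⟨g, hg0, hg, hgv⟩ := h'
  exact ⟨f * g, mul_ne_zero hf0 hg0, hf.mul hg, fun j => (hfv j).mul (hgv j)⟩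

theorem ExistsForm.mono [Nonempty σ] (h : ExistsForm v m t) {t' : ℕ} (ht : t ≤ t') :
    ExistsForm v m t' := by
  obtain ⟨i⟩ := ‹Nonempty σ›
  have h1 : ExistsForm v 0 (t' - t) :=
    ⟨X i ^ (t' - t), pow_ne_zero _ (X_ne_zero i), isHomogeneous_X_pow i _, fun _ => trivial⟩
  simpa [Nat.add_sub_cancel' ht] using h.mul h1

end ExistsForm

theorem ExistsForm.smul {ι σ S : Type*} [CommRing S] {v : ι → σ → S} {m t : ℕ}
    (h : ExistsForm v m t) (c : ι → S) :
    ExistsForm (fun j => c j • v j) m t := by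
  obtain ⟨f, hf0, hf, hfv⟩ := h
  exact ⟨f, hf0, hf, fun j => (hfv j).smul_point hf (c j)⟩

/-! ### Generic least degrees and their limit -/

section GenericDegree

variable (k : Type u) [Field k]

/-- The least degree of a nonzero form that vanishes to order `m` at `n` universal points of
`ℙ³`. -/
noncomputable def genericDegree (n m : ℕ) : ℕ :=
  sInf {t | ExistsForm (universalPoint k (Fin n) (Fin 4)) m t}

/-- The infimum is attained, not the default value 0 of an empty set: multiply the `m`-th powers of
a plane through each point. -/
theorem existsForm_genericDegree (n m : ℕ) :
    ExistsForm (universalPoint k (Fin n) (Fin 4)) m (genericDegree k n m) := by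
  refine Nat.sInf_mem (s := {t | ExistsForm (universalPoint k (Fin n) (Fin 4)) m t}) ?_
  let v := universalPoint k (Fin n) (Fin 4)
  let l : Fin n → MvPolynomial (Fin 4) (MvPolynomial (Fin n × Fin 4) k) := fun j =>
    C (v j 0) * X 1 - C (v j 1) * X 0
  have hl0 : ∀ j, l j ≠ 0 := by
    intro j h0
    have := congrArg (eval (Pi.single 1 1)) h0
    simp [l, v, universalPoint] at this
  refine ⟨∑ j : Fin n, 1 * m, ∏ j, l j ^ m,
    Finset.prod_ne_zero_iff.2 fun j _ => pow_ne_zero _ (hl0 j),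
    IsHomogeneous.prod _ _ _ fun j _ => (((isHomogeneous_X _ 1).C_mul _).sub
      ((isHomogeneous_X _ 0).C_mul _)).pow m, fun j => ?_⟩
  obtain ⟨g, hg⟩ := Finset.dvd_prod_of_mem (fun j => l j ^ m) (Finset.mem_univ j)
  rw [hg]
  have h1 : VanishesToOrder (v j) 1 (l j) := ⟨by simp [l, mul_comm], fun _ => trivial⟩
  simpa using (h1.pow m).mul_right g

theorem genericDegree_le {n m t : ℕ} (h : ExistsForm (universalPoint k (Fin n) (Fin 4)) m t) :
    genericDegree k n m ≤ t :=
  Nat.sInf_le h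

theorem genericDegree_add_le (n m m' : ℕ) :
    genericDegree k n (m + m') ≤ genericDegree k n m + genericDegree k n m' :=
  genericDegree_le k ((existsForm_genericDegree k n m).mul (existsForm_genericDegree k n m'))

theorem subadditive_genericDegree (n : ℕ) :
    Subadditive fun m => (genericDegree k n m : ℝ) := fun m m' => by
  beta_reduce
  exact_mod_cast genericDegree_add_le k n m m'

theorem tendsto_genericDegree_div (n : ℕ) :
    Tendsto (fun m : ℕ => (genericDegree k n m : ℝ) / m) atTop
      (𝓝 (subadditive_genericDegree k n).lim) := by
  refine (subadditive_genericDegree k n).tendsto_lim ⟨0, ?_⟩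
  rintro _ ⟨m, rfl⟩
  positivity

variable [CharZero k]

theorem exists_multihomogeneous_initialDegree_eq (n m : ℕ) :
    ∃ F : MvPolynomial (Fin n × Fin 4) k, IsMultihomogeneous F ∧ F ≠ 0 ∧
      ∀ (K : Type u) [Field K] [Algebra k K] (p : Fin n → P3 K), NonvanishingAt F p →
        initialDegree (symbolicPower (pointsIdeal p) m) = genericDegree k n m := by
  have hle : ∀ (K : Type u) [Field K] [Algebra k K] (p : Fin n → P3 K),
      genericDegree k n m ∈ {t | ExistsForm (fun j => (p j).rep) m t} := fun K _ _ p =>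
    (existsForm_genericDegree k n m).specialize _
  have hchar : ∀ (K : Type u) [Field K] [Algebra k K], CharZero K := fun K _ _ =>
    charZero_of_injective_algebraMap (algebraMap k K).injective
  rcases Nat.eq_zero_or_pos (genericDegree k n m) with h0 | hpos
  · refine ⟨1, ⟨0, isWeightedHomogeneous_one _ _⟩, one_ne_zero, fun K _ _ p _ => ?_⟩
    have := hchar K
    rw [initialDegree_symbolicPower_pointsIdeal]
    exact le_antisymm (Nat.sInf_le (hle K p)) (h0 ▸ Nat.zero_le _)
  -- Excluding the single degree just below the minimum suffices, because forms in a smaller degree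
  -- could be multiplied up to it.
  · have hno : ¬ ExistsForm (universalPoint k (Fin n) (Fin 4)) m (genericDegree k n m - 1) :=
      fun h => by have := genericDegree_le k h; omega
    obtain ⟨F, hF0, hF⟩ := exists_ne_zero_forall_not_existsForm hno
    obtain ⟨G, hG, hG0, hGF⟩ := exists_multihomogeneous_forall_smul hF0
    refine ⟨G, hG, hG0, fun K _ _ p hp => ?_⟩
    have := hchar K
    rw [initialDegree_symbolicPower_pointsIdeal]
    refine le_antisymm (Nat.sInf_le (hle K p)) (le_csInf ⟨_, hle K p⟩ fun t ht => ?_)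
    by_contra! hlt
    obtain ⟨c, hc⟩ := hGF K (fun j => (p j).rep) hp
    exact hF K (fun j => c j • (p j).rep) hc ((ht.mono (Nat.le_sub_one_of_lt hlt)).smul c)

theorem isGenericWaldschmidtConstant_lim (n : ℕ) :
    IsGenericWaldschmidtConstant k n (subadditive_genericDegree k n).lim := by
  choose F hF hF0 hFp using exists_multihomogeneous_initialDegree_eq k n
  refine ⟨fun K _ _ p hp => ?_, genericDegree k n, fun m => ?_, tendsto_genericDegree_div k n⟩
  · have h : ∀ m, initialDegree (symbolicPower (pointsIdeal p) m) = genericDegree k n m :=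
      fun m => hFp m K p (hp (F m) (hF m) (hF0 m))
    simpa only [HasWaldschmidtConstant, h] using tendsto_genericDegree_div k n
  · exact ⟨F m, hF m, hF0 m, fun p hp => hFp m k p hp⟩

/-- The squaring map of `ℙ³` has degree `8`, and the product of a form with its transforms under
sign changes descends along it. -/
theorem genericDegree_sixteen_mul_le {r n : ℕ} (hr : 1 ≤ r) (hn : r * 8 ≤ n) (m : ℕ) :
    genericDegree k r (16 * m) ≤ 8 * genericDegree k n m := by
  let D := MvPolynomial (Fin r × Fin 4) k
  let K := FractionRing D
  have hDK : Function.Injective (algebraMap D K) := IsFractionRing.injective D K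
  have : CharZero K := charZero_of_injective_algebraMap (algebraMap k K).injective
  let U : Fin r → Fin 4 → K := fun j i => algebraMap D K (X (j, i))
  have hU : ∀ j i, U j i ≠ 0 := fun j i h0 =>
    X_ne_zero (R := k) (j, i) (hDK (by rw [map_zero]; exact h0))
  -- Three signs suffice, as projectively the first one can be normalized to 1. Surplus points among
  -- the `n` repeat earlier ones.
  obtain ⟨φ, hφ⟩ : ∃ φ : Fin n → Fin r × (Fin 3 → ℤˣ), Function.Surjective φ := by
    have : Nonempty (Fin r) := ⟨⟨0, hr⟩⟩
    obtain ⟨e⟩ := Function.Embedding.nonempty_of_card_le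
      (α := Fin r × (Fin 3 → ℤˣ)) (β := Fin n) (by simpa using hn)
    exact ⟨Function.invFun e, Function.invFun_surjective e.injective⟩
  obtain ⟨f, hf0, hf, hfv⟩ := (existsForm_genericDegree k n m).specialize
    fun l => changeSigns (Fin.cons 1 (φ l).2 : Fin 4 → ℤˣ) (U (φ l).1)
  have hsq : ExistsForm (fun j i => U j i ^ 2) (16 * m) (8 * genericDegree k n m) := by
    refine existsForm_sq hU hf0 hf (by simp; ring) fun j e => ?_
    obtain ⟨l, hl⟩ := hφ (j, fun i => e 0 * e i.succ)
    have h1 := (hfv l).smul_point hf ((e 0 : ℤ) : K)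
    convert h1 using 1
    funext i
    simp only [hl, changeSigns, Pi.smul_apply, smul_eq_mul, ← mul_assoc]
    congr 1
    refine Fin.cases ?_ (fun i => ?_) i
    · simp
    · simp only [Fin.cons_succ]
      rw [← Int.cast_mul, ← Units.val_mul, ← mul_assoc, Int.units_mul_self, one_mul]
  by_contra! hlt
  have hno : ¬ ExistsForm (universalPoint k (Fin r) (Fin 4)) (16 * m)
      (8 * genericDegree k n m) := fun h => (genericDegree_le k h).not_gt hlt
  obtain ⟨F, hF0, hF⟩ := exists_ne_zero_forall_not_existsForm hno
  -- The squared coordinates are still algebraically independent: `F` evaluated at them is `expand 2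
  -- F`, which is nonzero.
  refine hF K (fun j i => U j i ^ 2) ?_ hsq
  have : aeval (fun x : Fin r × Fin 4 => U x.1 x.2 ^ 2) F = algebraMap D K (expand 2 F) := by
    have h1 : (aeval fun x : Fin r × Fin 4 => U x.1 x.2 ^ 2 : D →ₐ[k] K) =
        (IsScalarTower.toAlgHom k D K).comp (expand 2) := by
      ext x
      simp [U, D, expand_X]
    rw [h1]
    rfl
  rw [this]
  exact fun h0 => (expand_ne_zero two_pos).2 hF0 (hDK (by rw [h0, map_zero]))

theorem two_mul_lim_genericDegree_le {r n : ℕ} (hr : 1 ≤ r) (hn : r * 8 ≤ n) :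
    2 * (subadditive_genericDegree k r).lim ≤ (subadditive_genericDegree k n).lim := by
  have h1 : Tendsto (fun m : ℕ => 16 * m) atTop atTop :=
    tendsto_id.const_mul_atTop' (by norm_num)
  have h2 := ((tendsto_genericDegree_div k r).comp h1).const_mul 2
  refine le_of_tendsto_of_tendsto' h2 (tendsto_genericDegree_div k n) fun m => ?_
  rcases Nat.eq_zero_or_pos m with rfl | hm
  · simp
  have h3 : (genericDegree k r (16 * m) : ℝ) ≤ 8 * genericDegree k n m := by
    exact_mod_cast genericDegree_sixteen_mul_le k hr hn m
  have hm' : (0 : ℝ) < m := by exact_mod_cast hm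
  rw [Function.comp_apply, Nat.cast_mul, le_div_iff₀ hm']
  have h4 : 2 * ((genericDegree k r (16 * m) : ℝ) / ((16 : ℕ) * m)) * m =
      genericDegree k r (16 * m) / 8 := by
    push_cast
    field_simp
    ring
  rw [h4]
  linarith

theorem two_pow_mul_lim_genericDegree_le {r : ℕ} (hr : 1 ≤ r) (s : ℕ) :
    2 ^ s * (subadditive_genericDegree k r).lim ≤
      (subadditive_genericDegree k (r * 8 ^ s)).lim := by
  induction s with
  | zero => simp
  | succ s ih =>
    have h := two_mul_lim_genericDegree_le k (r := r * 8 ^ s) (n := r * 8 ^ (s + 1))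
      (Nat.mul_pos hr (by positivity)) (by rw [pow_succ, mul_assoc])
    rw [pow_succ']
    linarith

end GenericDegree

theorem mainTheorem8 (k : Type*) [Field k] [CharZero k] (r s n : ℕ) (hr : 1 ≤ r) (hs : 1 ≤ s)
    (hn : r * 8 ^ s ≤ n) :
    ∃ γn γr : ℝ, IsGenericWaldschmidtConstant k n γn ∧ IsGenericWaldschmidtConstant k r γr ∧
      2 ^ s * γr ≤ γn := by
  refine ⟨_, _, isGenericWaldschmidtConstant_lim k n, isGenericWaldschmidtConstant_lim k r, ?_⟩
  -- The last of the `s` squaring steps passes directly to `n`, which absorbs the excess of `n` over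
  -- `r * 8 ^ s`.
  obtain ⟨s, rfl⟩ := Nat.exists_eq_add_of_le' hs
  have h1 := two_pow_mul_lim_genericDegree_le k hr s
  have h2 := two_mul_lim_genericDegree_le k (r := r * 8 ^ s) (n := n)
    (Nat.mul_pos hr (by positivity)) (by rwa [mul_assoc, ← pow_succ])
  rw [pow_succ']
  linarith
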